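/- For $d \in \mathbb{N}$ let $\Delta_d = \{p \in \mathbb{R}^d : p_i \ge 0,\ \sum_i p_i = 1\}$, and for $p, q \in \Delta_d$ let $$\mathrm{JS}(p,q) = \sum_{i=1}^d \Big( p_i \log_2 \frac{2p_i}{p_i+q_i} + q_i \log_2 \frac{2q_i}{p_i+q_i} \Big)$$ be the Jensen–Shannon divergence (in bits; a summand with zero prefactor is $0$). Let $$\kappa(\omega) = \frac{2\,\mathrm{sech}(\pi\omega)}{(\ln 4)(1+4\omega^2)} .$$ For $\varepsilon > 0$ put $J = \max\big(0, \big\lceil \tfrac{32d}{\varepsilon} \ln \tfrac{8d}{\varepsilon} \big\rceil\big)$ and $w_j = j\,\varepsilon/(32d)$ for $j \in \mathbb{Z}$. For $p \in \Delta_d$ the algorithm outputs the vector $c^p = c^p_{d,\varepsilon} \in \mathbb{R}^{N}$, $N = N(d,\varepsilon) = 4dJ$, obtained by concatenating the vectors $a^p$ and $b^p$ whose entries, for $i = 1, \dots, d$ and $j = -J, \dots, J-1$ in lexicographic order, are $$\sqrt{p_i}\,\cos(w_j \ln p_i)\,\sqrt{\int_{w_j}^{w_{j+1}} \kappa(\omega)\,d\omega}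 \quad\text{and}\quad \sqrt{p_i}\,\sin(w_j \ln p_i)\,\sqrt{\int_{w_j}^{w_{j+1}} \kappa(\omega)\,d\omega}$$ respectively (both are $0$ if $p_i = 0$). **Theorem.** The map $p \mapsto c^p$ embeds $\Delta_d$, and hence every set $P \subseteq \Delta_d$ whatever its size, under $\mathrm{JS}$ into $\ell_2^2$ of dimension $N(d,\varepsilon) = O\big(\frac{d^2}{\varepsilon} \log \frac{d}{\varepsilon}\big)$ with additive error $\varepsilon$. Precisely: 1. For all $d$, all $\varepsilon > 0$ and all $p, q \in \Delta_d$, $\ \big|\, \|c^p - c^q\|_2^2 - \mathrm{JS}(p,q) \,\big| \le \varepsilon$. 2. If $0 < \varepsilon < 8d$, then $p \mapsto c^p$ is one-to-one on $\Delta_d$. 3. For every $r > 1$ there is a constant $C > 0$ such that $N(d,\varepsilon) \le C\, \frac{d^2}{\varepsilon} \ln \frac{d}{\varepsilon}$ for all $d$ and all $\varepsilon > 0$ with $d/\varepsilon \ge r$. -/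

import Mathlib

namespace JSEmbed

/-- The Jensen–Shannon divergence `∑ᵢ pᵢ log₂ (2pᵢ/(pᵢ+qᵢ)) + qᵢ log₂ (2qᵢ/(pᵢ+qᵢ))`, in bits.
A summand with zero prefactor is `0`, whatever the argument of its logarithm. -/
noncomputable def jsDiv {d : ℕ} (p q : Fin d → ℝ) : ℝ :=
  ∑ i, (p i * Real.logb 2 (2 * p i / (p i + q i)) + q i * Real.logb 2 (2 * q i / (p i + q i)))

/-- The spectral density `κ(ω) = 2 sech(π ω) / ((ln 4)(1 + 4 ω²))`. -/
noncomputable def kappa (ω : ℝ) : ℝ :=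
  2 * (1 / Real.cosh (Real.pi * ω)) / (Real.log 4 * (1 + 4 * ω ^ 2))

/-- The truncation level `J = ⌈(32d/ε) ln(8d/ε)⌉` of the algorithm. If the number inside is not
positive, `J` is `0`, and the loop over `-J ≤ j ≤ J - 1` is empty. -/
noncomputable def truncLevel (d : ℕ) (ε : ℝ) : ℕ :=
  ⌈32 * (d : ℝ) / ε * Real.log (8 * d / ε)⌉₊

/-- The grid points `w_j = j ε / (32 d)`. -/
noncomputable def gridPt (d : ℕ) (ε : ℝ) (j : ℤ) : ℝ :=
  j * (ε / (32 * d))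

/-- The weight `√(∫_{w_j}^{w_{j+1}} κ)` of a grid cell. -/
noncomputable def cellWeight (d : ℕ) (ε : ℝ) (j : ℤ) : ℝ :=
  Real.sqrt (∫ ω in (gridPt d ε j)..(gridPt d ε (j + 1)), kappa ω)

/-- The number of values taken by the counter `ℓ` of the algorithm: `i` runs through `d` values,
and for each of them `j` runs through the `2J` values `-J, …, J - 1`. -/
noncomputable def numSteps (d : ℕ) (ε : ℝ) : ℕ := d * (2 * truncLevel d ε)

/-- The coordinate index `i` at step `ℓ` (the outer loop). -/
noncomputable def stepCoord (d : ℕ) (ε : ℝ) (l : Fin (numSteps d ε)) : Fin d :=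
  (finProdFinEquiv.symm (l : Fin (d * (2 * truncLevel d ε)))).1

/-- The frequency index `j ∈ {-J, …, J - 1}` at step `ℓ` (the inner loop). -/
noncomputable def stepFreq (d : ℕ) (ε : ℝ) (l : Fin (numSteps d ε)) : ℤ :=
  -(truncLevel d ε : ℤ) + ((finProdFinEquiv.symm (l : Fin (d * (2 * truncLevel d ε)))).2 : ℕ)

/-- The vector `a^p` (cosine part). A coordinate `pᵢ = 0` contributes zeros. -/
noncomputable def cosPart (d : ℕ) (ε : ℝ) (p : Fin d → ℝ) (l : Fin (numSteps d ε)) : ℝ :=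
  Real.sqrt (p (stepCoord d ε l)) *
    Real.cos (gridPt d ε (stepFreq d ε l) * Real.log (p (stepCoord d ε l))) *
    cellWeight d ε (stepFreq d ε l)

/-- The vector `b^p` (sine part). -/
noncomputable def sinPart (d : ℕ) (ε : ℝ) (p : Fin d → ℝ) (l : Fin (numSteps d ε)) : ℝ :=
  Real.sqrt (p (stepCoord d ε l)) *
    Real.sin (gridPt d ε (stepFreq d ε l) * Real.log (p (stepCoord d ε l))) *
    cellWeight d ε (stepFreq d ε l)

/-- The length of the output vector. -/
noncomputable def outDim (d : ℕ) (ε : ℝ) : ℕ := numSteps d ε + numSteps d ε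

/-- The output of the algorithm on input `p`: `a^p` concatenated with `b^p`, in Euclidean space. -/
noncomputable def embed (d : ℕ) (ε : ℝ) (p : Fin d → ℝ) : EuclideanSpace ℝ (Fin (outDim d ε)) :=
  WithLp.toLp 2 (Fin.append (cosPart d ε p) (sinPart d ε p))

end JSEmbed

namespace JSEmbed

open MeasureTheory Set Filter Topology Real

/-! ### The Fourier transform of the hyperbolic secant -/

/-! Each summand of the divergence is a squared Hilbert-space distance: it equals `∫ κ(ω) |√x e^{iω
ln x} - √y e^{iω ln y}|² dω` with `κ` a probability density (`integral_kappa_mul_waveDist`). The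
algorithm replaces this integral by a left Riemann sum on `[-Jδ, Jδ]`, with `δ = ε/(32d)`, and
`norm_embed_sub_sq` identifies that sum with the squared distance of the outputs.

The identity reduces to the cosine transform of `κ`. The reflection formula for `Γ` gives the
transform of sech; writing `1/(1+4ω²)` as a Laplace integral of a cosine and applying Fubini leaves
an elementary integral.

Two estimates control the error of a summand. The squared distance is `4(x+y)`-Lipschitz in `ω`,
with no lower bound on `x` or `y` (`abs_waveDist_sub_le`), and it is at most `2(x+y)` while `κ`
decays exponentially (`abs_integral_sub_truncated_le`, `one_sub_integral_kappa_le`). Both bounds are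
linear in `x+y`, and these masses sum to 2 over the coordinates. -/

lemma exp_abs_le_two_mul_cosh (x : ℝ) : exp |x| ≤ 2 * cosh x := by
  rw [cosh_eq]
  rcases abs_cases x with ⟨h, _⟩ | ⟨h, _⟩ <;> rw [h] <;> nlinarith [exp_pos x, exp_pos (-x)]

lemma one_add_sq_le_four_mul_cosh (x : ℝ) : 1 + x ^ 2 ≤ 4 * cosh x := by
  have h := quadratic_le_exp_of_nonneg (abs_nonneg x)
  rw [sq_abs] at h
  nlinarith [exp_abs_le_two_mul_cosh x, abs_nonneg x]

lemma integrable_inv_cosh : Integrable fun x : ℝ => (cosh x)⁻¹ := by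
  refine (integrable_inv_one_add_sq.const_mul 4).mono'
    (continuous_cosh.inv₀ fun x => (cosh_pos x).ne').aestronglyMeasurable (ae_of_all _ fun x => ?_)
  rw [norm_of_nonneg (inv_nonneg.2 (cosh_pos x).le), ← div_eq_mul_inv, inv_eq_one_div,
    div_le_div_iff₀ (cosh_pos x) (by positivity)]
  linarith [one_add_sq_le_four_mul_cosh x]

lemma integrable_inv_cosh_mul {c : ℝ} (hc : c ≠ 0) : Integrable fun x : ℝ => (cosh (c * x))⁻¹ :=
  integrable_inv_cosh.comp_mul_left' hc

lemma integrable_mul_bounded {f g : ℝ → ℝ} (hf : Integrable f) (hg : Continuous g) {C : ℝ}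
    (h : ∀ x, |g x| ≤ C) : Integrable fun x => f x * g x :=
  hf.mul_bdd hg.aestronglyMeasurable (ae_of_all _ h)

lemma log_sigmoid (t : ℝ) : log (sigmoid t) = t / 2 - log (2 * cosh (t / 2)) := by
  rw [sigmoid_def, log_inv, ← sub_eq_zero]
  have h : 1 + exp (-t) = exp (-(t / 2)) * (2 * cosh (t / 2)) := by
    rw [cosh_eq]
    have h1 : exp (-(t / 2)) * exp (t / 2) = 1 := by rw [← exp_add]; simp
    have h2 : exp (-(t / 2)) * exp (-(t / 2)) = exp (-t) := by rw [← exp_add]; ring_nf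
    linear_combination -h1 - h2
  rw [h, log_mul (exp_pos _).ne' (by have := cosh_pos (t / 2); positivity), log_exp]
  ring

/-- Substitute `x = sigmoid t`; the Jacobian `x(1-x)` absorbs the two `-1`s in the exponents. -/
lemma betaIntegral_eq_integral_sigmoid (u v : ℂ) :
    Complex.betaIntegral u v = ∫ t : ℝ, (sigmoid t : ℂ) ^ u * (sigmoid (-t) : ℂ) ^ v := by
  have h := integral_image_eq_integral_abs_deriv_smul (s := univ) (f := sigmoid)
    (f' := fun x => sigmoid x * (1 - sigmoid x)) MeasurableSet.univ
    (fun x _ => (hasDerivAt_sigmoid x).hasDerivWithinAt) sigmoid_injective.injOn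
    (fun x : ℝ => (x : ℂ) ^ (u - 1) * (1 - (x : ℂ)) ^ (v - 1))
  rw [image_univ, range_sigmoid, setIntegral_univ] at h
  rw [Complex.betaIntegral, intervalIntegral.integral_of_le zero_le_one, integral_Ioc_eq_integral_Ioo,
    h]
  refine integral_congr_ae (ae_of_all _ fun t => ?_)
  have h1 := sigmoid_pos t
  have h2 := sigmoid_pos (-t)
  have h3 : (1 : ℂ) - (sigmoid t : ℂ) = (sigmoid (-t) : ℂ) := by rw [sigmoid_neg]; push_cast; rfl
  have h1' : (sigmoid t : ℂ) ≠ 0 := by exact_mod_cast h1.ne'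
  have h2' : (sigmoid (-t) : ℂ) ≠ 0 := by exact_mod_cast h2.ne'
  simp only [← sigmoid_neg, h3]
  rw [abs_of_pos (mul_pos h1 h2), Complex.real_smul, Complex.cpow_sub _ _ h1',
    Complex.cpow_sub _ _ h2', Complex.cpow_one, Complex.cpow_one]
  push_cast
  field_simp

/-- Euler's reflection formula at `u = 1/2 + iξ`: `Γ(u)Γ(1-u) = π / sin(πu)`, and `sin(πu) =
cosh(πξ)`. On the Beta side, the odd part of `log (sigmoid t)` yields the phase and the even part
yields the sech. -/
lemma integral_exp_mul_I_div_cosh (ξ : ℝ) :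
    ∫ t : ℝ, Complex.exp (ξ * t * Complex.I) * ((2 * cosh (t / 2))⁻¹ : ℝ) = (π / cosh (π * ξ) : ℝ) := by
  have h1 : (0 : ℝ) < (1 / 2 + ξ * Complex.I : ℂ).re := by simp
  have h2 : (0 : ℝ) < (1 - (1 / 2 + ξ * Complex.I) : ℂ).re := by simp; norm_num
  have h := Complex.Gamma_mul_Gamma_eq_betaIntegral h1 h2
  rw [Complex.Gamma_mul_Gamma_one_sub, add_sub_cancel, Complex.Gamma_one, one_mul,
    betaIntegral_eq_integral_sigmoid] at h
  have hs : Complex.sin (π * (1 / 2 + ξ * Complex.I)) = (cosh (π * ξ) : ℝ) := by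
    rw [mul_add, ← mul_assoc, mul_one_div, add_comm, Complex.sin_add_pi_div_two, Complex.cos_mul_I]
    push_cast; rfl
  rw [hs] at h
  push_cast at h ⊢
  rw [h]
  refine integral_congr_ae (ae_of_all _ fun t => ?_)
  have hc : 0 < 2 * cosh (t / 2) := by have := cosh_pos (t / 2); positivity
  have e1 : ((2 * cosh (t / 2))⁻¹ : ℝ) = exp (-log (2 * cosh (t / 2))) := by
    rw [exp_neg, exp_log hc]
  have e1' : (2 * Complex.cosh ((t : ℂ) / 2))⁻¹ = Complex.exp (-(log (2 * cosh (t / 2)) : ℝ)) := by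
    have := congrArg (fun x : ℝ => (x : ℂ)) e1
    push_cast at this ⊢
    exact this
  simp only
  rw [e1', Complex.cpow_def_of_ne_zero (by exact_mod_cast (sigmoid_pos t).ne'),
    Complex.cpow_def_of_ne_zero (by exact_mod_cast (sigmoid_pos (-t)).ne'),
    ← Complex.ofReal_log (sigmoid_pos t).le, ← Complex.ofReal_log (sigmoid_pos (-t)).le,
    log_sigmoid, log_sigmoid, ← Complex.exp_add, ← Complex.exp_add, neg_div, cosh_neg]
  congr 1
  push_cast
  ring

lemma integral_cos_div_cosh (v : ℝ) :
    ∫ ω : ℝ, (cosh (π * ω))⁻¹ * cos (2 * ω * v) = (cosh v)⁻¹ := by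
  have h := integral_exp_mul_I_div_cosh (v / π)
  have hi : Integrable fun t : ℝ => Complex.exp ((v / π : ℝ) * t * Complex.I) *
      ((2 * cosh (t / 2))⁻¹ : ℝ) := by
    have h0 : Integrable fun t : ℝ => (((2 * cosh (t / 2))⁻¹ : ℝ) : ℂ) := by
      refine Integrable.ofReal (((integrable_inv_cosh_mul (c := 2⁻¹) (by norm_num)).const_mul
        2⁻¹).congr (ae_of_all _ fun t => ?_))
      change 2⁻¹ * (cosh (2⁻¹ * t))⁻¹ = (2 * cosh (t / 2))⁻¹
      rw [mul_inv, div_eq_inv_mul]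
    refine h0.bdd_mul (c := 1) (by fun_prop) (ae_of_all _ fun t => ?_)
    rw [← Complex.ofReal_mul, Complex.norm_exp_ofReal_mul_I]
  have h' := congrArg Complex.re h
  rw [← RCLike.re_eq_complex_re, ← integral_re hi] at h'
  simp only [RCLike.re_eq_complex_re, ← Complex.ofReal_mul, Complex.re_mul_ofReal,
    Complex.exp_ofReal_mul_I_re, Complex.ofReal_re] at h'
  have hs := Measure.integral_comp_mul_left
    (fun t : ℝ => cos (v / π * t) * (2 * cosh (t / 2))⁻¹) (2 * π)
  rw [h', mul_div_cancel₀ _ pi_ne_zero, abs_of_pos (by positivity), smul_eq_mul] at hs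
  have e : ∀ ω : ℝ, cos (v / π * (2 * π * ω)) * (2 * cosh (2 * π * ω / 2))⁻¹ =
      2⁻¹ * ((cosh (π * ω))⁻¹ * cos (2 * ω * v)) := fun ω => by
    rw [show v / π * (2 * π * ω) = 2 * ω * v by field_simp,
      show 2 * π * ω / 2 = π * ω by ring, mul_inv]
    ring
  simp only [e] at hs
  rw [integral_const_mul] at hs
  have := pi_pos
  have hc := cosh_pos v
  generalize ∫ ω : ℝ, (cosh (π * ω))⁻¹ * cos (2 * ω * v) = X at hs ⊢
  field_simp at hs ⊢
  linarith

/-! ### The cosine transform of the spectral density -/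

lemma integral_exp_neg_mul_cos (ω : ℝ) :
    ∫ t in Ioi (0 : ℝ), exp (-t) * cos (2 * ω * t) = (1 + 4 * ω ^ 2)⁻¹ := by
  have ha : ((-1 + 2 * ω * Complex.I : ℂ)).re < 0 := by simp
  have h := integral_exp_mul_complex_Ioi ha 0
  have hi := integrableOn_exp_mul_complex_Ioi ha 0
  have h' := congrArg Complex.re h
  rw [← RCLike.re_eq_complex_re, ← integral_re hi] at h'
  have e : ∀ t : ℝ, RCLike.re (Complex.exp ((-1 + 2 * ω * Complex.I) * t)) =
      exp (-t) * cos (2 * ω * t) := fun t => by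
    rw [RCLike.re_eq_complex_re, Complex.exp_re]
    simp
  simp only [e] at h'
  rw [h']
  simp [Complex.div_re, Complex.normSq_apply]
  ring

/-- The integrand has the antiderivative `-e^u log(1 + e^{-2(u+t)})`, which vanishes at infinity. As
the integrand is nonnegative, convergence of the antiderivative also gives integrability. -/
lemma integral_exp_neg_div_cosh (u : ℝ) :
    IntegrableOn (fun t : ℝ => exp (-t) * (cosh (u + t))⁻¹) (Ioi 0) ∧
    ∫ t in Ioi (0 : ℝ), exp (-t) * (cosh (u + t))⁻¹ = exp u * log (1 + exp (-(2 * u))) := by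
  have hd : ∀ t ∈ Ici (0 : ℝ), HasDerivAt (fun t : ℝ => -(exp u * log (1 + exp (-(2 * (u + t))))))
      (exp (-t) * (cosh (u + t))⁻¹) t := fun t _ => by
    have h1 : HasDerivAt (fun t : ℝ => 1 + exp (-(2 * (u + t)))) (exp (-(2 * (u + t))) * -(2 * 1)) t :=
      ((((hasDerivAt_id t).const_add u).const_mul 2).neg.exp).const_add 1
    have hp : 1 + exp (-(2 * (u + t))) ≠ 0 := by positivity
    refine ((h1.log hp).const_mul (exp u)).neg.congr_deriv ?_
    have hc : cosh (u + t) = exp (u + t) * (1 + exp (-(2 * (u + t)))) / 2 := by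
      rw [cosh_eq, mul_add, ← exp_add]; ring_nf
    rw [hc]
    have h2 : exp (-(2 * (u + t))) = exp (-u) * exp (-t) * (exp (-u) * exp (-t)) := by
      rw [← exp_add, ← exp_add]; ring_nf
    have h3 : exp (u + t) = exp u * exp t := exp_add _ _
    field_simp
    rw [h2, h3]
    have h4 : exp u * exp (-u) = 1 := by rw [← exp_add]; simp
    have h5 : exp t * exp (-t) = 1 := by rw [← exp_add]; simp
    linear_combination
      (exp u * exp (-u) * exp t * exp (-t) * exp (-t) + exp (-t) * (exp t * exp (-t))) * h4 +
      exp (-t) * h5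
  have hn : ∀ t ∈ Ioi (0 : ℝ), 0 ≤ exp (-t) * (cosh (u + t))⁻¹ := fun t _ => by
    have := cosh_pos (u + t); positivity
  have hl : Tendsto (fun t : ℝ => -(exp u * log (1 + exp (-(2 * (u + t)))))) atTop (𝓝 0) := by
    have h1 : Tendsto (fun t : ℝ => 1 + exp (-(2 * (u + t)))) atTop (𝓝 (1 + 0)) :=
      (tendsto_exp_neg_atTop_nhds_zero.comp
        ((tendsto_atTop_add_const_left _ u tendsto_id).const_mul_atTop two_pos)).const_add 1
    have h2 := ((h1.log (by norm_num)).const_mul (exp u)).neg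
    simpa using h2
  exact ⟨integrableOn_Ioi_deriv_of_nonneg' hd hn hl, by
    rw [integral_Ioi_of_hasDerivAt_of_nonneg' hd hn hl]; simp⟩

/-- Replace `1/(1+4ω²)` by `∫ e^{-t} cos(2ωt) dt` over `t > 0`, swap the integrals, and split the
product of cosines into frequencies `u+t` and `u-t`; the inner integrals are then sech transforms.
-/
lemma integral_cos_div_cosh_mul_one_add_sq (u : ℝ) :
    ∫ ω : ℝ, (cosh (π * ω))⁻¹ * (1 + 4 * ω ^ 2)⁻¹ * cos (2 * ω * u) =
      (exp u * log (1 + exp (-(2 * u))) + exp (-u) * log (1 + exp (2 * u))) / 2 := by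
  have hi := integrable_inv_cosh_mul pi_ne_zero
  have he : IntegrableOn (fun t : ℝ => exp (-t)) (Ioi 0) := integrableOn_exp_neg_Ioi 0
  have hF : Integrable (Function.uncurry fun ω t : ℝ =>
      (cosh (π * ω))⁻¹ * exp (-t) * (cos (2 * ω * u) * cos (2 * ω * t)))
      (volume.prod (volume.restrict (Ioi 0))) := by
    refine (hi.mul_prod he).mul_bdd (c := 1)
      (g := fun z : ℝ × ℝ => cos (2 * z.1 * u) * cos (2 * z.1 * z.2))
      (by fun_prop) (ae_of_all _ fun z => ?_)
    rw [norm_mul]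
    exact mul_le_one₀ (abs_cos_le_one _) (norm_nonneg _) (abs_cos_le_one _)
  have hsw := integral_integral_swap hF
  have e1 : ∀ ω : ℝ, ∫ t in Ioi (0 : ℝ), (cosh (π * ω))⁻¹ * exp (-t) *
      (cos (2 * ω * u) * cos (2 * ω * t)) =
      (cosh (π * ω))⁻¹ * (1 + 4 * ω ^ 2)⁻¹ * cos (2 * ω * u) := fun ω => by
    rw [← integral_exp_neg_mul_cos, ← integral_const_mul, ← integral_mul_const]
    refine integral_congr_ae (ae_of_all _ fun t => ?_)
    ring
  have e2 : ∀ t : ℝ, ∫ ω : ℝ, (cosh (π * ω))⁻¹ * exp (-t) * (cos (2 * ω * u) * cos (2 * ω * t)) =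
      2⁻¹ * (exp (-t) * (cosh (u + t))⁻¹ + exp (-t) * (cosh (-u + t))⁻¹) := fun t => by
    rw [← cosh_neg (-u + t), show -(-u + t) = u - t by ring, ← integral_cos_div_cosh (u + t),
      ← integral_cos_div_cosh (u - t), ← mul_add, ← integral_add
        (integrable_mul_bounded hi (by fun_prop) fun x => abs_cos_le_one _)
        (integrable_mul_bounded hi (by fun_prop) fun x => abs_cos_le_one _),
      ← integral_const_mul, ← integral_const_mul]
    refine integral_congr_ae (ae_of_all _ fun ω => ?_)
    simp only
    rw [mul_add (2 * ω), mul_sub (2 * ω), cos_add, cos_sub]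
    ring
  simp only [e1, e2] at hsw
  have h1 := integral_exp_neg_div_cosh u
  have h2 := integral_exp_neg_div_cosh (-u)
  rw [hsw, integral_const_mul, integral_add h1.1 h2.1, h1.2, h2.2]
  simp only [mul_neg, neg_neg]
  ring

/-! ### The spectral density as a probability density -/

lemma kappa_eq (ω : ℝ) : kappa ω = (log 2)⁻¹ * ((cosh (π * ω))⁻¹ * (1 + 4 * ω ^ 2)⁻¹) := by
  have h4 : log 4 = 2 * log 2 := by
    rw [show (4 : ℝ) = 2 ^ 2 by norm_num, log_pow]; norm_num
  have := log_pos one_lt_two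
  have := cosh_pos (π * ω)
  have : 0 < 1 + 4 * ω ^ 2 := by positivity
  rw [kappa, h4]
  field_simp

lemma kappa_pos (ω : ℝ) : 0 < kappa ω := by
  have := log_pos one_lt_two
  have := cosh_pos (π * ω)
  rw [kappa_eq]
  positivity

lemma kappa_neg (ω : ℝ) : kappa (-ω) = kappa ω := by
  simp [kappa]

lemma continuous_kappa : Continuous kappa := by
  have h : kappa = fun ω => (log 2)⁻¹ * ((cosh (π * ω))⁻¹ * (1 + 4 * ω ^ 2)⁻¹) := funext kappa_eq
  rw [h]
  refine continuous_const.mul (Continuous.mul (Continuous.inv₀ (by fun_prop) fun x => (cosh_pos _).ne')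
    (Continuous.inv₀ (by fun_prop) fun x => by positivity))

lemma integrable_kappa : Integrable kappa := by
  have h : kappa = fun ω => (log 2)⁻¹ * ((cosh (π * ω))⁻¹ * (1 + 4 * ω ^ 2)⁻¹) := funext kappa_eq
  rw [h]
  refine Integrable.const_mul (integrable_mul_bounded (C := 1)
    (g := fun ω => (1 + 4 * ω ^ 2)⁻¹) (integrable_inv_cosh_mul pi_ne_zero)
    (Continuous.inv₀ (by fun_prop) fun x => by positivity) fun x => ?_) _
  rw [abs_of_nonneg (by positivity)]
  exact inv_le_one_of_one_le₀ (by nlinarith [sq_nonneg x])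

lemma integral_kappa_mul_cos (u : ℝ) : ∫ ω, kappa ω * cos (ω * (2 * u)) =
    (exp u * log (1 + exp (-(2 * u))) + exp (-u) * log (1 + exp (2 * u))) / (2 * log 2) := by
  have h : ∀ ω, kappa ω * cos (ω * (2 * u)) =
      (log 2)⁻¹ * ((cosh (π * ω))⁻¹ * (1 + 4 * ω ^ 2)⁻¹ * cos (2 * ω * u)) := fun ω => by
    rw [kappa_eq, mul_left_comm ω 2 u, ← mul_assoc 2 ω u]; ring
  simp only [h]
  rw [integral_const_mul, integral_cos_div_cosh_mul_one_add_sq]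
  have := log_pos one_lt_two
  field_simp

lemma integral_kappa : ∫ ω, kappa ω = 1 := by
  have h := integral_kappa_mul_cos 0
  have := log_pos one_lt_two
  simp only [mul_zero, cos_zero, mul_one] at h
  rw [h]
  norm_num
  field_simp
  norm_num

/-- The squared distance between `√x e^{iω ln x}` and `√y e^{iω ln y}`. -/
noncomputable def waveDist (x y ω : ℝ) : ℝ :=
  x + y - 2 * (√x * √y) * cos (ω * (log x - log y))

lemma waveDist_eq {x y : ℝ} (hx : 0 ≤ x) (hy : 0 ≤ y) (ω : ℝ) :
    waveDist x y ω = (√x * cos (ω * log x) - √y * cos (ω * log y)) ^ 2 +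
      (√x * sin (ω * log x) - √y * sin (ω * log y)) ^ 2 := by
  rw [waveDist, mul_sub, cos_sub]
  linear_combination (-x) * sin_sq_add_cos_sq (ω * log x) - y * sin_sq_add_cos_sq (ω * log y) -
    (cos (ω * log x) ^ 2 + sin (ω * log x) ^ 2) * sq_sqrt hx -
    (cos (ω * log y) ^ 2 + sin (ω * log y) ^ 2) * sq_sqrt hy

lemma continuous_waveDist (x y : ℝ) : Continuous (waveDist x y) := by
  unfold waveDist; fun_prop

lemma continuous_kappa_mul_waveDist (x y : ℝ) : Continuous fun ω => kappa ω * waveDist x y ω :=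
  continuous_kappa.mul (continuous_waveDist x y)

lemma waveDist_nonneg {x y : ℝ} (hx : 0 ≤ x) (hy : 0 ≤ y) (ω : ℝ) : 0 ≤ waveDist x y ω := by
  rw [waveDist_eq hx hy]; positivity

lemma two_mul_sqrt_mul_sqrt_le {x y : ℝ} (hx : 0 ≤ x) (hy : 0 ≤ y) : 2 * (√x * √y) ≤ x + y := by
  nlinarith [sq_nonneg (√x - √y), sq_sqrt hx, sq_sqrt hy]

lemma waveDist_le {x y : ℝ} (hx : 0 ≤ x) (hy : 0 ≤ y) (ω : ℝ) :
    waveDist x y ω ≤ 2 * (x + y) := by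
  have h := two_mul_sqrt_mul_sqrt_le hx hy
  have h0 : 0 ≤ 2 * (√x * √y) := by positivity
  rw [waveDist]
  nlinarith [neg_one_le_cos (ω * (log x - log y))]

/-- A form of the inequality between the geometric and the logarithmic mean. -/
lemma sqrt_mul_sqrt_mul_abs_log_sub_log_le {x y : ℝ} (hx : 0 ≤ x) (hy : 0 ≤ y) :
    √x * √y * |log x - log y| ≤ 2 * (x + y) := by
  wlog h : y ≤ x generalizing x y
  · have := this hy hx (le_of_not_ge h)
    rwa [mul_comm √y, abs_sub_comm, add_comm] at this
  rcases hy.eq_or_lt with rfl | hy'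
  · simp [hx]
  have hx' := hy'.trans_le h
  -- `log t ≤ t - 1` at `t = √x/√y`; the factor `√y` then clears the denominator.
  have h1 := log_le_sub_one_of_pos (div_pos (sqrt_pos.2 hx') (sqrt_pos.2 hy'))
  rw [log_div (sqrt_pos.2 hx').ne' (sqrt_pos.2 hy').ne', log_sqrt hx, log_sqrt hy] at h1
  rw [abs_of_nonneg (sub_nonneg.2 (log_le_log hy' h))]
  have h2 : √x * √y * (log x - log y) ≤ √x * √y * (2 * (√x / √y - 1)) :=
    mul_le_mul_of_nonneg_left (by linarith) (by positivity)
  have h3 : √x * √y * (2 * (√x / √y - 1)) = 2 * (√x ^ 2 - √x * √y) := by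
    have := (sqrt_pos.2 hy').ne'
    field_simp
  rw [h3, sq_sqrt hx] at h2
  nlinarith [sqrt_nonneg x, sqrt_nonneg y, mul_nonneg (sqrt_nonneg x) (sqrt_nonneg y)]

/-- The phase speed `|log x - log y|` is unbounded, but the amplitude `√x √y` compensates for it, so
the grid spacing need not depend on the smallest probability. -/
lemma abs_waveDist_sub_le {x y : ℝ} (hx : 0 ≤ x) (hy : 0 ≤ y) (a b : ℝ) :
    |waveDist x y a - waveDist x y b| ≤ 4 * (x + y) * |a - b| := by
  have h1 : |cos (b * (log x - log y)) - cos (a * (log x - log y))| ≤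
      |log x - log y| * |a - b| := by
    refine (abs_cos_sub_cos_le _ _).trans_eq ?_
    rw [← sub_mul, abs_mul, abs_sub_comm, mul_comm]
  have h2 : waveDist x y a - waveDist x y b =
      2 * (√x * √y) * (cos (b * (log x - log y)) - cos (a * (log x - log y))) := by
    rw [waveDist, waveDist]; ring
  have h0 : 0 ≤ √x * √y := by positivity
  rw [h2, abs_mul, abs_of_nonneg (by positivity)]
  calc _ ≤ 2 * (√x * √y) * (|log x - log y| * |a - b|) := by gcongr
    _ = 2 * (√x * √y * |log x - log y|) * |a - b| := by ring
    _ ≤ 2 * (2 * (x + y)) * |a - b| :=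
      mul_le_mul_of_nonneg_right (mul_le_mul_of_nonneg_left
        (sqrt_mul_sqrt_mul_abs_log_sub_log_le hx hy) two_pos.le) (abs_nonneg _)
    _ = _ := by ring

lemma integrable_kappa_mul_waveDist {x y : ℝ} (hx : 0 ≤ x) (hy : 0 ≤ y) :
    Integrable fun ω => kappa ω * waveDist x y ω :=
  integrable_mul_bounded integrable_kappa (continuous_waveDist x y) fun ω => by
    rw [abs_of_nonneg (waveDist_nonneg hx hy ω)]; exact waveDist_le hx hy ω

/-- The integral representation of a summand of the Jensen–Shannon divergence. -/
lemma integral_kappa_mul_waveDist {x y : ℝ} (hx : 0 ≤ x) (hy : 0 ≤ y) :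
    ∫ ω, kappa ω * waveDist x y ω =
      x * logb 2 (2 * x / (x + y)) + y * logb 2 (2 * y / (x + y)) := by
  -- If a coordinate vanishes, so does the cosine term, since `√0 = 0`; the default value `log 0 =
  -- 0` is harmless. What remains is the other coordinate times the total mass 1.
  rcases hx.eq_or_lt with rfl | hx'
  · rcases hy.eq_or_lt with rfl | hy'
    · simp [waveDist]
    · simp [waveDist, integral_mul_const, integral_kappa, hy'.ne']
  rcases hy.eq_or_lt with rfl | hy'
  · simp [waveDist, integral_mul_const, integral_kappa, hx'.ne']
  -- With this `u`, the products `√x √y e^{±u}` are `x` and `y`, which turns the cosine transform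
  -- into the two logarithmic terms.
  set u := (log x - log y) / 2 with hu
  have hl := log_pos one_lt_two
  have e : ∀ ω, kappa ω * waveDist x y ω =
      kappa ω * (x + y) - 2 * (√x * √y) * (kappa ω * cos (ω * (2 * u))) := fun ω => by
    rw [waveDist, hu, mul_div_cancel₀ _ two_ne_zero]; ring
  simp only [e]
  rw [integral_sub (integrable_kappa.mul_const _) ((integrable_mul_bounded integrable_kappa
    (by fun_prop) fun ω => abs_cos_le_one _).const_mul _), integral_mul_const, integral_const_mul,
    integral_kappa, integral_kappa_mul_cos]
  have ex : √x = exp (log x / 2) := by rw [← log_sqrt hx, exp_log (sqrt_pos.2 hx')]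
  have ey : √y = exp (log y / 2) := by rw [← log_sqrt hy, exp_log (sqrt_pos.2 hy')]
  have h1 : √x * √y * exp u = x := by
    rw [ex, ey, ← exp_add, ← exp_add]
    conv_rhs => rw [← exp_log hx']
    congr 1; rw [hu]; ring
  have h2 : √x * √y * exp (-u) = y := by
    rw [ex, ey, ← exp_add, ← exp_add]
    conv_rhs => rw [← exp_log hy']
    congr 1; rw [hu]; ring
  have h3 : exp (2 * u) = x / y := by
    rw [hu, mul_div_cancel₀ _ two_ne_zero, exp_sub, exp_log hx', exp_log hy']
  have h4 : exp (-(2 * u)) = y / x := by rw [exp_neg, h3, inv_div]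
  have hxy : 0 < x + y := by positivity
  rw [h3, h4, show 1 + y / x = (x + y) / x by field_simp,
    show 1 + x / y = (x + y) / y by field_simp; ring, log_div hxy.ne' hx'.ne',
    log_div hxy.ne' hy'.ne', logb, logb, log_div (by positivity) hxy.ne',
    log_div (by positivity) hxy.ne', log_mul two_ne_zero hx'.ne', log_mul two_ne_zero hy'.ne']
  field_simp
  linear_combination (-(log (x + y) - log x)) * h1 - (log (x + y) - log y) * h2

/-! ### Truncation and discretization -/

lemma kappa_le_exp {ω : ℝ} (h : 0 ≤ ω) : kappa ω ≤ 4 * exp (-3 * ω) := by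
  have h4 : 1 ≤ log 4 := by
    rw [le_log_iff_exp_le (by norm_num)]; linarith [exp_one_lt_d9]
  have hc : exp (3 * ω) ≤ 2 * cosh (π * ω) := by
    refine le_trans (exp_le_exp.2 ?_) (exp_abs_le_two_mul_cosh _)
    exact (mul_le_mul_of_nonneg_right pi_gt_three.le h).trans (le_abs_self _)
  have hcp := cosh_pos (π * ω)
  have he := exp_pos (3 * ω)
  have hd : 1 ≤ log 4 * (1 + 4 * ω ^ 2) := one_le_mul_of_one_le_of_one_le h4 (by nlinarith)
  rw [kappa, neg_mul, exp_neg]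
  calc _ ≤ 2 * (1 / cosh (π * ω)) := div_le_self (by positivity) hd
    _ = 4 * (2 * cosh (π * ω))⁻¹ := by field_simp; norm_num
    _ ≤ _ := by gcongr

lemma one_sub_integral_kappa_le {W : ℝ} (hW : 0 ≤ W) :
    1 - ∫ ω in (-W)..W, kappa ω ≤ 8 / 3 * exp (-3 * W) := by
  have hk := integrable_kappa
  have h1 := intervalIntegral.integral_Iic_add_Ioi (b := W) hk.integrableOn hk.integrableOn
  have h2 := intervalIntegral.integral_Iic_sub_Iic (a := -W) (b := W) hk.integrableOn hk.integrableOn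
  have h3 : ∫ ω in Iic (-W), kappa ω = ∫ ω in Ioi W, kappa ω := by
    have := integral_comp_neg_Ioi W kappa
    simp only [kappa_neg] at this
    exact this.symm
  have h4 : ∫ ω in Ioi W, kappa ω ≤ ∫ ω in Ioi W, 4 * exp (-3 * ω) :=
    setIntegral_mono_on hk.integrableOn ((integrableOn_exp_mul_Ioi (by norm_num) W).const_mul 4)
      measurableSet_Ioi fun ω hω => kappa_le_exp (hW.trans (le_of_lt hω))
  rw [integral_const_mul, integral_exp_mul_Ioi (by norm_num)] at h4
  rw [integral_kappa] at h1
  linarith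

lemma integral_kappa_interval_nonneg {a b : ℝ} (h : a ≤ b) : 0 ≤ ∫ ω in a..b, kappa ω :=
  intervalIntegral.integral_nonneg h fun ω _ => (kappa_pos ω).le

lemma integral_kappa_interval_le_one {a b : ℝ} (h : a ≤ b) : ∫ ω in a..b, kappa ω ≤ 1 := by
  rw [intervalIntegral.integral_of_le h, ← integral_kappa]
  exact setIntegral_le_integral integrable_kappa (ae_of_all _ fun ω => (kappa_pos ω).le)

/-- The integrand lies between `0` and `2(x+y)κ`, so the discarded part is at most `2(x+y)` times
the discarded mass of `κ`. -/
lemma abs_integral_sub_truncated_le {x y W : ℝ} (hx : 0 ≤ x) (hy : 0 ≤ y) (hW : 0 ≤ W) :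
    |(∫ ω in (-W)..W, kappa ω * waveDist x y ω) - ∫ ω, kappa ω * waveDist x y ω| ≤
      2 * (x + y) * (1 - ∫ ω in (-W)..W, kappa ω) := by
  have hi := integrable_kappa_mul_waveDist hx hy
  have hj := (integrable_kappa.mul_const (2 * (x + y))).sub hi
  have hle : -W ≤ W := by linarith
  have h1 := setIntegral_le_integral (s := Ioc (-W) W) hi
    (ae_of_all _ fun ω => mul_nonneg (kappa_pos ω).le (waveDist_nonneg hx hy ω))
  have h2 := setIntegral_le_integral (s := Ioc (-W) W) hj (ae_of_all _ fun ω => by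
    simp only [Pi.zero_apply, Pi.sub_apply, ← mul_sub]
    exact mul_nonneg (kappa_pos ω).le (sub_nonneg.2 (waveDist_le hx hy ω)))
  simp only [Pi.sub_apply] at h2
  rw [integral_sub (integrable_kappa.mul_const _).integrableOn hi.integrableOn,
    integral_sub (integrable_kappa.mul_const _) hi, integral_mul_const, integral_mul_const,
    integral_kappa] at h2
  rw [intervalIntegral.integral_of_le hle, intervalIntegral.integral_of_le hle, abs_le]
  constructor <;> nlinarith

/-- Weighting by the exact mass of the cell leaves only the variation of `waveDist`. The bound
carries that mass, so summing over cells costs a factor at most 1, however many cells there are. -/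
lemma abs_mul_integral_sub_integral_le {x y a b : ℝ} (hx : 0 ≤ x) (hy : 0 ≤ y) (hab : a ≤ b) :
    |waveDist x y a * (∫ ω in a..b, kappa ω) - ∫ ω in a..b, kappa ω * waveDist x y ω| ≤
      4 * (x + y) * (b - a) * ∫ ω in a..b, kappa ω := by
  have hk : ∀ a b, IntervalIntegrable kappa volume a b := fun a b => continuous_kappa.intervalIntegrable _ _
  rw [← intervalIntegral.integral_const_mul, ← intervalIntegral.integral_const_mul,
    ← intervalIntegral.integral_sub ((hk a b).const_mul _)
      ((continuous_kappa_mul_waveDist x y).intervalIntegrable _ _)]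
  rw [← norm_eq_abs]
  refine intervalIntegral.norm_integral_le_of_norm_le hab (ae_of_all _ fun ω hω => ?_)
    ((hk a b).const_mul _)
  rw [mul_comm (kappa ω), ← sub_mul, norm_mul, norm_of_nonneg (kappa_pos ω).le]
  refine mul_le_mul_of_nonneg_right ((abs_waveDist_sub_le hx hy a ω).trans ?_) (kappa_pos ω).le
  refine mul_le_mul_of_nonneg_left ?_ (by positivity)
  rw [abs_sub_comm, abs_of_pos (sub_pos.2 hω.1)]
  linarith [hω.2]

/-- The error of the left Riemann sum with `2 J` cells of width `δ` for the integral
representation of a summand of the Jensen–Shannon divergence. -/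
lemma abs_riemannSum_sub_integral_le {x y δ : ℝ} (hx : 0 ≤ x) (hy : 0 ≤ y) (hδ : 0 ≤ δ) (J : ℕ) :
    |(∑ k ∈ Finset.range (2 * J), waveDist x y ((k - J) * δ) *
        ∫ ω in ((k - J) * δ)..((k - J + 1) * δ), kappa ω) - ∫ ω, kappa ω * waveDist x y ω| ≤
      4 * (x + y) * δ + 2 * (x + y) * (1 - ∫ ω in (-(J * δ))..(J * δ), kappa ω) := by
  have hW : 0 ≤ J * δ := by positivity
  have hsum : ∀ f : ℝ → ℝ, Continuous f → ∑ k ∈ Finset.range (2 * J),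
      ∫ ω in ((k - J) * δ)..((k - J + 1) * δ), f ω = ∫ ω in (-(J * δ))..(J * δ), f ω := by
    intro f hf
    have := intervalIntegral.sum_integral_adjacent_intervals (f := f) (μ := volume)
      (a := fun k : ℕ => ((k : ℝ) - J) * δ) (n := 2 * J) fun k _ => hf.intervalIntegrable _ _
    convert this using 2
    · push_cast; ring_nf
    · push_cast; ring
    · push_cast; ring
  have h1 := abs_integral_sub_truncated_le hx hy hW
  refine (abs_sub_le _ _ _).trans (add_le_add ?_ h1)
  rw [← hsum _ (continuous_kappa_mul_waveDist x y), ← Finset.sum_sub_distrib]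
  refine (Finset.abs_sum_le_sum_abs _ _).trans ?_
  calc _ ≤ ∑ k ∈ Finset.range (2 * J), 4 * (x + y) * δ *
        ∫ ω in (((k : ℝ) - J) * δ)..((k - J + 1) * δ), kappa ω := by
        refine Finset.sum_le_sum fun k _ => ?_
        have := abs_mul_integral_sub_integral_le hx hy
          (show ((k : ℝ) - J) * δ ≤ (k - J + 1) * δ by nlinarith)
        rwa [show ((k : ℝ) - J + 1) * δ - (k - J) * δ = δ by ring] at this
    _ = 4 * (x + y) * δ * ∫ ω in (-(J * δ))..(J * δ), kappa ω := by
        rw [← Finset.mul_sum, hsum _ continuous_kappa]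
    _ ≤ 4 * (x + y) * δ * 1 := by
        gcongr; exact integral_kappa_interval_le_one (by linarith)
    _ = _ := mul_one _

/-! ### The embedding -/

lemma gridPt_mono {d : ℕ} {ε : ℝ} (hε : 0 < ε) (j : ℤ) : gridPt d ε j ≤ gridPt d ε (j + 1) := by
  unfold gridPt
  have : 0 ≤ ε / (32 * d) := by positivity
  push_cast
  nlinarith

lemma cellWeight_sq {d : ℕ} {ε : ℝ} (hε : 0 < ε) (j : ℤ) :
    cellWeight d ε j ^ 2 = ∫ ω in (gridPt d ε j)..(gridPt d ε (j + 1)), kappa ω :=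
  sq_sqrt (integral_kappa_interval_nonneg (gridPt_mono hε j))

lemma embed_castAdd (d : ℕ) (ε : ℝ) (p : Fin d → ℝ) (l : Fin (numSteps d ε)) :
    embed d ε p (Fin.castAdd (numSteps d ε) l) = cosPart d ε p l :=
  Fin.append_left _ _ l

lemma embed_natAdd (d : ℕ) (ε : ℝ) (p : Fin d → ℝ) (l : Fin (numSteps d ε)) :
    embed d ε p (Fin.natAdd (numSteps d ε) l) = sinPart d ε p l :=
  Fin.append_right _ _ l

lemma norm_embed_sub_sq {d : ℕ} {ε : ℝ} (hε : 0 < ε) {p q : Fin d → ℝ}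
    (hp : ∀ i, 0 ≤ p i) (hq : ∀ i, 0 ≤ q i) :
    ‖embed d ε p - embed d ε q‖ ^ 2 = ∑ i, ∑ k ∈ Finset.range (2 * truncLevel d ε),
      waveDist (p i) (q i) ((k - truncLevel d ε) * (ε / (32 * d))) *
        ∫ ω in ((k - truncLevel d ε) * (ε / (32 * d)))..((k - truncLevel d ε + 1) * (ε / (32 * d))),
          kappa ω := by
  rw [EuclideanSpace.norm_sq_eq]
  have h1 : ∑ l, ‖(embed d ε p - embed d ε q) l‖ ^ 2 =
      ∑ l : Fin (numSteps d ε), ((cosPart d ε p l - cosPart d ε q l) ^ 2 +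
        (sinPart d ε p l - sinPart d ε q l) ^ 2) := by
    rw [Finset.sum_add_distrib]
    refine (Fin.sum_univ_add (a := numSteps d ε) (b := numSteps d ε)
      fun l => ‖(embed d ε p - embed d ε q) l‖ ^ 2).trans ?_
    have ha (l : Fin (numSteps d ε)) : (embed d ε p - embed d ε q) (Fin.castAdd (numSteps d ε) l) =
        cosPart d ε p l - cosPart d ε q l :=
      congrArg₂ (· - ·) (embed_castAdd d ε p l) (embed_castAdd d ε q l)
    have hb (l : Fin (numSteps d ε)) : (embed d ε p - embed d ε q) (Fin.natAdd (numSteps d ε) l) =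
        sinPart d ε p l - sinPart d ε q l :=
      congrArg₂ (· - ·) (embed_natAdd d ε p l) (embed_natAdd d ε q l)
    simp only [norm_eq_abs, sq_abs]
    exact congrArg₂ (· + ·) (Finset.sum_congr rfl fun l _ => congrArg (· ^ 2) (ha l))
      (Finset.sum_congr rfl fun l _ => congrArg (· ^ 2) (hb l))
  rw [h1]
  have h2 : ∀ l : Fin (numSteps d ε), (cosPart d ε p l - cosPart d ε q l) ^ 2 +
      (sinPart d ε p l - sinPart d ε q l) ^ 2 =
      waveDist (p (stepCoord d ε l)) (q (stepCoord d ε l)) (gridPt d ε (stepFreq d ε l)) *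
        cellWeight d ε (stepFreq d ε l) ^ 2 := fun l => by
    rw [waveDist_eq (hp _) (hq _), cosPart, cosPart, sinPart, sinPart]; ring
  simp only [h2, cellWeight_sq hε]
  refine (Equiv.sum_comp (finProdFinEquiv (m := d) (n := 2 * truncLevel d ε)) (fun l =>
    waveDist (p (stepCoord d ε l)) (q (stepCoord d ε l)) (gridPt d ε (stepFreq d ε l)) *
      ∫ ω in (gridPt d ε (stepFreq d ε l))..(gridPt d ε (stepFreq d ε l + 1)), kappa ω)).symm.trans ?_
  rw [Fintype.sum_prod_type]
  refine Finset.sum_congr rfl fun i _ => ?_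
  rw [← Fin.sum_univ_eq_sum_range (fun k : ℕ =>
    waveDist (p i) (q i) ((k - truncLevel d ε) * (ε / (32 * d))) *
        ∫ ω in ((k - truncLevel d ε) * (ε / (32 * d)))..((k - truncLevel d ε + 1) * (ε / (32 * d))),
          kappa ω)]
  refine Finset.sum_congr rfl fun k _ => ?_
  simp only [stepCoord, stepFreq, Equiv.symm_apply_apply, gridPt]
  push_cast
  rw [neg_add_eq_sub]

lemma jsDiv_eq_sum_integral {d : ℕ} {p q : Fin d → ℝ} (hp : ∀ i, 0 ≤ p i) (hq : ∀ i, 0 ≤ q i) :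
    jsDiv p q = ∑ i, ∫ ω, kappa ω * waveDist (p i) (q i) ω :=
  Finset.sum_congr rfl fun i _ => (integral_kappa_mul_waveDist (hp i) (hq i)).symm

lemma abs_norm_embed_sub_sq_sub_jsDiv_le {d : ℕ} {ε : ℝ} (hε : 0 < ε) {p q : Fin d → ℝ}
    (hp : p ∈ stdSimplex ℝ (Fin d)) (hq : q ∈ stdSimplex ℝ (Fin d)) :
    |‖embed d ε p - embed d ε q‖ ^ 2 - jsDiv p q| ≤ 8 * (ε / (32 * d)) +
      4 * (1 - ∫ ω in (-(truncLevel d ε * (ε / (32 * d))))..(truncLevel d ε * (ε / (32 * d))),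
        kappa ω) := by
  rw [norm_embed_sub_sq hε hp.1 hq.1, jsDiv_eq_sum_integral hp.1 hq.1, ← Finset.sum_sub_distrib]
  refine (Finset.abs_sum_le_sum_abs _ _).trans ((Finset.sum_le_sum fun i _ =>
    abs_riemannSum_sub_integral_le (hp.1 i) (hq.1 i) (by positivity) _).trans_eq ?_)
  rw [Finset.sum_add_distrib]
  simp only [← Finset.sum_mul, ← Finset.mul_sum, Finset.sum_add_distrib, hp.2, hq.2]
  norm_num

lemma abs_norm_embed_sub_sq_sub_jsDiv_le_of_two_le {d : ℕ} (hd : 2 ≤ d) {ε : ℝ} (hε : 0 < ε)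
    {p q : Fin d → ℝ} (hp : p ∈ stdSimplex ℝ (Fin d)) (hq : q ∈ stdSimplex ℝ (Fin d)) :
    |‖embed d ε p - embed d ε q‖ ^ 2 - jsDiv p q| ≤ ε := by
  refine (abs_norm_embed_sub_sq_sub_jsDiv_le hε hp hq).trans ?_
  have hd' : (2 : ℝ) ≤ d := by exact_mod_cast hd
  set W := truncLevel d ε * (ε / (32 * d)) with hWdef
  have hW : 0 ≤ W := by positivity
  have h8 : 8 * (ε / (32 * d)) ≤ ε / 8 := by
    rw [mul_div_assoc', div_le_div_iff₀ (by positivity) (by norm_num)]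
    nlinarith
  -- If `ε ≥ 8d ≥ 16`, the trivial tail bound 4 is at most `ε/4`, and no decay is needed.
  rcases le_total (8 * (d : ℝ)) ε with h | h
  · have := integral_kappa_interval_nonneg (show -W ≤ W by linarith)
    linarith
  · have hlog : log (8 * d / ε) ≤ W := by
      have h1 : 32 * (d : ℝ) / ε * log (8 * d / ε) ≤ truncLevel d ε := Nat.le_ceil _
      have h2 := mul_le_mul_of_nonneg_right h1 (show 0 ≤ ε / (32 * d) by positivity)
      rwa [mul_right_comm, div_mul_div_cancel₀ hε.ne', div_self (by positivity), one_mul] at h2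
    have h3 : exp (-3 * W) ≤ ε / (8 * d) := by
      calc exp (-3 * W) ≤ exp (-log (8 * d / ε)) := exp_le_exp.2 (by linarith)
        _ = ε / (8 * d) := by rw [exp_neg, exp_log (by positivity), inv_div]
    have h4 : ε / (8 * d) ≤ ε / 16 := by gcongr; linarith
    -- The budget is `ε/8` for discretization and `4 · (8/3) · ε/16 = 2ε/3` for truncation.
    linarith [one_sub_integral_kappa_le hW]

lemma stdSimplex_eq_of_le_one {d : ℕ} (hd : d ≤ 1) {p q : Fin d → ℝ}
    (hp : p ∈ stdSimplex ℝ (Fin d)) (hq : q ∈ stdSimplex ℝ (Fin d)) : p = q := by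
  have : Subsingleton (Fin d) := Fin.subsingleton_iff_le_one.2 hd
  funext i
  have h1 := hp.2
  have h2 := hq.2
  rw [Fintype.sum_subsingleton _ i] at h1 h2
  rw [h1, h2]

lemma jsDiv_self {d : ℕ} (p : Fin d → ℝ) : jsDiv p p = 0 := by
  refine Finset.sum_eq_zero fun i _ => ?_
  rcases eq_or_ne (p i) 0 with h | h
  · simp [h]
  · rw [← two_mul (p i), div_self (mul_ne_zero two_ne_zero h)]; simp

lemma cellWeight_zero_pos {d : ℕ} {ε : ℝ} (hd : 0 < d) (hε : 0 < ε) : 0 < cellWeight d ε 0 := by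
  refine sqrt_pos.2 (intervalIntegral.intervalIntegral_pos_of_pos
    (continuous_kappa.intervalIntegrable _ _) kappa_pos ?_)
  have : (0 : ℝ) < d := by exact_mod_cast hd
  simp only [gridPt]
  push_cast
  have : 0 < ε / (32 * d) := by positivity
  linarith

lemma truncLevel_pos {d : ℕ} {ε : ℝ} (hε : 0 < ε) (h : ε < 8 * d) : 0 < truncLevel d ε := by
  have hd : (0 : ℝ) < d := by linarith
  refine Nat.ceil_pos.2 (mul_pos (by positivity) (log_pos ?_))
  rwa [one_lt_div hε]

/-! ### Injectivity and the target dimension -/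

lemma embed_injOn {d : ℕ} {ε : ℝ} (hε : 0 < ε) (h : ε < 8 * d) :
    Set.InjOn (embed d ε) (stdSimplex ℝ (Fin d)) := by
  intro p hp q hq hpq
  have hd : 0 < d := by
    have : (0 : ℝ) < d := by linarith
    exact_mod_cast this
  have hJ := truncLevel_pos hε h
  funext i
  -- Inner index `J` is frequency `j = 0`, present because `J > 0`. There the cosine is 1, so the
  -- entry is `√pᵢ` times a positive weight and determines `pᵢ`.
  let l : Fin (numSteps d ε) :=
    finProdFinEquiv (i, (⟨truncLevel d ε, by omega⟩ : Fin (2 * truncLevel d ε)))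
  have hi : stepCoord d ε l = i := by simp [stepCoord, l]
  have hj : stepFreq d ε l = 0 := by simp [stepFreq, l]
  have hg : gridPt d ε 0 = 0 := by simp [gridPt]
  have hl : cosPart d ε p l = cosPart d ε q l := by
    rw [← embed_castAdd, hpq, embed_castAdd]
  rw [cosPart, cosPart, hi, hj, hg, zero_mul, zero_mul, cos_zero, mul_one, mul_one] at hl
  exact (sqrt_inj (hp.1 i) (hq.1 i)).1 (mul_right_cancel₀ (cellWeight_zero_pos hd hε).ne' hl)

lemma exists_outDim_le {r : ℝ} (hr : 1 < r) : ∃ C : ℝ, 0 < C ∧ ∀ (d : ℕ) (ε : ℝ), 0 < ε →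
    r ≤ d / ε → (outDim d ε : ℝ) ≤ C * ((d : ℝ) ^ 2 / ε * log (d / ε)) := by
  have hlr := log_pos hr
  have h8 : 0 < log 8 := log_pos (by norm_num)
  -- The 4 comes from `N = 4dJ`; `log 8 / log r` absorbs the 8 inside the logarithm and `1 / log r`
  -- the rounding up, both through `log(d/ε) ≥ log r`.
  refine ⟨4 * (32 * (log 8 / log r + 1) + 1 / log r), by positivity, fun d ε hε hx => ?_⟩
  set x := (d : ℝ) / ε with hxdef
  have hx0 : 0 < x := by linarith
  have hlx : log r ≤ log x := log_le_log (by linarith) hx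
  have e1 : 32 * (d : ℝ) / ε = 32 * x := by rw [hxdef]; ring
  have e2 : 8 * (d : ℝ) / ε = 8 * x := by rw [hxdef]; ring
  have e3 : (d : ℝ) ^ 2 / ε = d * x := by rw [hxdef]; ring
  have hone : 1 ≤ log x / log r := (one_le_div hlr).2 hlx
  have hJ : (truncLevel d ε : ℝ) ≤ 32 * x * (log 8 + log x) + 1 := by
    rw [truncLevel, e1, e2, log_mul (by norm_num) hx0.ne']
    exact (Nat.ceil_lt_add_one (by have := hlr.trans_le hlx; positivity)).le
  have h1 : log 8 + log x ≤ (log 8 / log r + 1) * log x := by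
    have := le_mul_of_one_le_right h8.le hone
    calc _ ≤ log 8 * (log x / log r) + log x := by linarith
      _ = _ := by ring
  have h2 : 1 ≤ 1 / log r * (x * log x) := by
    calc 1 ≤ x * (log x / log r) := one_le_mul_of_one_le_of_one_le (by linarith) hone
      _ = _ := by ring
  have h3 : (truncLevel d ε : ℝ) ≤ (32 * (log 8 / log r + 1) + 1 / log r) * (x * log x) := by
    have := mul_le_mul_of_nonneg_left h1 (show 0 ≤ 32 * x by positivity)
    linarith
  rw [e3]
  calc (outDim d ε : ℝ) = 4 * d * truncLevel d ε := by
        simp only [outDim, numSteps]; push_cast; ring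
    _ ≤ 4 * d * ((32 * (log 8 / log r + 1) + 1 / log r) * (x * log x)) := by gcongr
    _ = _ := by ring

end JSEmbed

theorem mainTheorem2 :
    -- additive error at most `ε` between any two points of the simplex
    (∀ (d : ℕ) (ε : ℝ), 0 < ε →
      ∀ p ∈ stdSimplex ℝ (Fin d), ∀ q ∈ stdSimplex ℝ (Fin d),
        |‖JSEmbed.embed d ε p - JSEmbed.embed d ε q‖ ^ 2 - JSEmbed.jsDiv p q| ≤ ε) ∧
    -- the map is one-to-one
    (∀ (d : ℕ) (ε : ℝ), 0 < ε → ε < 8 * d →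
      Set.InjOn (JSEmbed.embed d ε) (stdSimplex ℝ (Fin d))) ∧
    -- the target dimension is `O((d²/ε) log(d/ε))`, for `d/ε` bounded away from `1`
    (∀ r : ℝ, 1 < r → ∃ C : ℝ, 0 < C ∧ ∀ (d : ℕ) (ε : ℝ), 0 < ε → r ≤ d / ε →
      (JSEmbed.outDim d ε : ℝ) ≤ C * ((d : ℝ) ^ 2 / ε * Real.log (d / ε))) := by
  refine ⟨fun d ε hε p hp q hq => ?_, fun d ε => JSEmbed.embed_injOn,
    fun r => JSEmbed.exists_outDim_le⟩
  -- For `d = 1` the truncation estimate would exceed `ε`, but for `d ≤ 1` the simplex has at most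
  -- one point.
  rcases le_or_gt d 1 with hd | hd
  · rw [JSEmbed.stdSimplex_eq_of_le_one hd hp hq, JSEmbed.jsDiv_self]
    simpa using hε.le
  · exact JSEmbed.abs_norm_embed_sub_sq_sub_jsDiv_le_of_two_le hd hε hp hq
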